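/- For a Boolean function $f:\mathbb F_2^n\to\{0,1\}$ and an invertible linear transformation $B$ of $\mathbb F_2^n$ put $f_B(x)=f(Bx)$. Let $C^1(f)$ be the smallest $k$ such that for every $x$ with $f(x)=1$ there is a set $S$ of at most $k$ coordinates such that $f(x')=1$ for every $x'$ agreeing with $x$ on $S$; let $C^0(f)=C^1(1-f)$ and $C(f)=\max\{C^0(f),C^1(f)\}$ (certificate complexity). Let $\mathrm{bs}(f,x)$ be the largest number $k$ of pairwise disjoint sets $S_1,\dots,S_k$ of coordinates such that, for every $i$, flipping the bits of $x$ indexed by $S_i$ changes the value of $f$; let $\mathrm{bs}(f)=\max_x\mathrm{bs}(f,x)$ (block sensitivity). Put $C_I(f)=\min_B C(f_B)$ and $\mathrm{bs}_I(f)=\min_B \mathrm{bs}(f_B)$, where $B$ ranges over the invertible linear transformations of $\mathbb F_2^n$. Let $C_\oplus(f,x)$ be the least co-dimension of a coset (affine subspace) of $\mathbb F_2^n$ that contains $x$ and on which $f$ is constant, and $C_\oplus(f)=\max_x C_\oplus(f,x)$ (parity certificate complexity). Let $\mathrm{wbs}_\oplus(f)=\max_x\min_B \mathrm{bs}(f_B,B^{-1}x)$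 and let $\mathrm{bs}_\oplus(f)=\max_H \mathrm{wbs}_\oplus(f|_H)$ (parity block sensitivity), where $H$ ranges over the cosets of $\mathbb F_2^n$ and $f|_H$, with $m=\dim H$, is regarded as the function $y\mapsto f(c+y_1e_1+\dots+y_me_m)$ on $\mathbb F_2^m$ for a point $c\in H$ and a basis $e_1,\dots,e_m$ of the direction of $H$ (the value of $\mathrm{wbs}_\oplus$ does not depend on these choices). Then there are constants $K,c,\delta>0$ such that for infinitely many $n$ there is a function $f_n:\mathbb F_2^n\to\{0,1\}$ for which the gaps between $C_\oplus(f_n)$ and $C_I(f_n)$ and between $\mathrm{bs}_\oplus(f_n)$ and $\mathrm{bs}_I(f_n)$ are both exponential, in the following sense: $$C_\oplus(f_n)\le K\log n,\qquad C_I(f_n)\ge c\,n,\qquad C_I(f_n)\ge 2^{\delta\, C_\oplus(f_n)},$$ $$\mathrm{bs}_\oplus(f_n)\le K\log n,\qquad \mathrm{bs}_I(f_n)\ge c\sqrt n,\qquad \mathrm{bs}_I(f_n)\ge 2^{\delta\, \mathrm{bs}_\oplus(f_n)}.$$ -/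

import Mathlib

namespace ParityComplexity

/-- The cube `{0,1}^n`, as the vector space `𝔽₂ⁿ`. -/
abbrev Cube (n : ℕ) : Type := Fin n → ZMod 2

/-- Boolean functions `f : {0,1}^n → {0,1}`. -/
abbrev BoolFun (n : ℕ) : Type := Cube n → Bool

/-- The function `f_B : x ↦ f (B x)`, for an invertible linear transformation `B` of `𝔽₂ⁿ`. -/
def rotate {n : ℕ} (f : BoolFun n) (B : Cube n ≃ₗ[ZMod 2] Cube n) : BoolFun n :=
  fun x => f (B x)

/-- The `1`-certificate complexity `C¹(f)`: the smallest `k` such that every `x` with `f x = 1`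
has a set `S` of at most `k` coordinates such that every `x'` that agrees with `x` on `S`
satisfies `f x' = 1`. -/
noncomputable def certOne {n : ℕ} (f : BoolFun n) : ℕ :=
  sInf {k : ℕ | ∀ x : Cube n, f x = true →
    ∃ S : Finset (Fin n), S.card ≤ k ∧
      ∀ x' : Cube n, (∀ i ∈ S, x' i = x i) → f x' = true}

/-- The `0`-certificate complexity `C⁰(f) = C¹(1 - f)`. -/
noncomputable def certZero {n : ℕ} (f : BoolFun n) : ℕ :=
  certOne (fun x => !(f x))

/-- The certificate complexity `C(f) = max (C⁰(f), C¹(f))`. -/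
noncomputable def cert {n : ℕ} (f : BoolFun n) : ℕ :=
  max (certZero f) (certOne f)

/-- The rotation-invariant (symmetrized) certificate complexity `C_I(f) = min_B C(f_B)`. -/
noncomputable def certInv {n : ℕ} (f : BoolFun n) : ℕ :=
  ⨅ B : Cube n ≃ₗ[ZMod 2] Cube n, cert (rotate f B)

/-- The co-dimension of a coset `b + V` of `𝔽₂ⁿ`. -/
noncomputable def codim {n : ℕ} (S : AffineSubspace (ZMod 2) (Cube n)) : ℕ :=
  n - Module.finrank (ZMod 2) S.direction

/-- `S` is a parity certificate of `f` on `x`: a coset containing `x` on which `f` is constant. -/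
def IsParityCert {n : ℕ} (f : BoolFun n) (x : Cube n)
    (S : AffineSubspace (ZMod 2) (Cube n)) : Prop :=
  x ∈ S ∧ ∀ y ∈ S, f y = f x

/-- `C_⊕(f, x)`: the least co-dimension of a parity certificate of `f` on `x`. -/
noncomputable def parityCertAt {n : ℕ} (f : BoolFun n) (x : Cube n) : ℕ :=
  sInf {k : ℕ | ∃ S : AffineSubspace (ZMod 2) (Cube n), IsParityCert f x S ∧ codim S = k}

/-- The parity certificate complexity `C_⊕(f) = max_x C_⊕(f, x)`. -/
noncomputable def parityCert {n : ℕ} (f : BoolFun n) : ℕ :=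
  Finset.univ.sup fun x : Cube n => parityCertAt f x

/-- `x^S`: the input `x` with every bit indexed by `S` flipped. -/
def flip {n : ℕ} (x : Cube n) (S : Finset (Fin n)) : Cube n :=
  fun i => if i ∈ S then x i + 1 else x i

/-- `bs(f, x)`: the largest number `k` of pairwise disjoint blocks `S₁, …, S_k` of coordinates
such that `f (x^{S_i}) ≠ f x` for every `i`. (A sensitive block is non-empty, so `k ≤ n` and the
supremum is a maximum.) -/
noncomputable def bsAt {n : ℕ} (f : BoolFun n) (x : Cube n) : ℕ :=
  sSup {k : ℕ | ∃ S : Fin k → Finset (Fin n),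
    (∀ i j, i ≠ j → Disjoint (S i) (S j)) ∧ ∀ i, f (flip x (S i)) ≠ f x}

/-- The block sensitivity `bs(f) = max_x bs(f, x)`. -/
noncomputable def bs {n : ℕ} (f : BoolFun n) : ℕ :=
  Finset.univ.sup fun x : Cube n => bsAt f x

/-- The rotation-invariant (symmetrized) block sensitivity `bs_I(f) = min_B bs(f_B)`. -/
noncomputable def bsInv {n : ℕ} (f : BoolFun n) : ℕ :=
  ⨅ B : Cube n ≃ₗ[ZMod 2] Cube n, bs (rotate f B)

/-- The weak parity block sensitivity on `x`: `wbs_⊕(f, x) = min_B bs(f_B, B⁻¹ x)`. -/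
noncomputable def weakParityBsAt {n : ℕ} (f : BoolFun n) (x : Cube n) : ℕ :=
  ⨅ B : Cube n ≃ₗ[ZMod 2] Cube n, bsAt (rotate f B) (B.symm x)

/-- The weak parity block sensitivity `wbs_⊕(f) = max_x wbs_⊕(f, x)`. -/
noncomputable def weakParityBs {n : ℕ} (f : BoolFun n) : ℕ :=
  Finset.univ.sup fun x : Cube n => weakParityBsAt f x

/-- The restriction of `f` to a coset `H`, written as a Boolean function of `m = dim H` variables
through a base point `c` and a basis `e₁, …, e_m` of the direction of `H`:
`y ↦ f (c + y₁ e₁ + ⋯ + y_m e_m)`. -/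
noncomputable def restrictCoset {n m : ℕ} (f : BoolFun n) (H : AffineSubspace (ZMod 2) (Cube n)) (c : Cube n)
    (e : Module.Basis (Fin m) (ZMod 2) H.direction) : BoolFun m :=
  fun y => f (c + ∑ i, y i • (e i : Cube n))

/-- The parity block sensitivity `bs_⊕(f) = max_H wbs_⊕(f|_H)`, over the cosets `H` of `𝔽₂ⁿ`.
The value `wbs_⊕(f|_H)` does not depend on the base point `c ∈ H` and the basis `e` that are used
to write `f|_H` as a Boolean function, because `wbs_⊕` is invariant under shifts and rotations;
so the maximum may run over all of these too. -/
noncomputable def parityBs {n : ℕ} (f : BoolFun n) : ℕ :=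
  sSup {k : ℕ | ∃ (m : ℕ) (H : AffineSubspace (ZMod 2) (Cube n)) (c : Cube n)
    (e : Module.Basis (Fin m) (ZMod 2) H.direction),
      c ∈ H ∧ weakParityBs (restrictCoset f H c e) = k}

end ParityComplexity

namespace ParityComplexity

/-! The functions are `parityAddress P h`: read an address `P x` of `k = log₂ n + 2` bits, answer
with the parity of `x` that `h` stores there. Fixing the address and that single parity is a parity
certificate, so `C_⊕ ≤ k + 1`, and `bs_⊕ ≤ C_⊕` for every function. If some rotation had
certificates of `s` coordinates, each `h a` would be a combination of the rows of `P` and of at most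
`s` rows of one invertible matrix. With `4n` addresses and `s = n / 32`, counting shows that some
`h` defeats all matrices at once (`exists_family_forall_exists_notMem`, `lt_certInv_parityAddress`),
so `C_I > n / 32`. The bound on `bs_I` then follows from `C ≤ bs²`. -/

/-! ### Certificates versus block sensitivity. -/

theorem flip_eq_add {n : ℕ} (x : Cube n) (S : Finset (Fin n)) :
    flip x S = x + fun i => if i ∈ S then 1 else 0 := by
  funext i
  by_cases h : i ∈ S <;> simp [flip, h]

theorem flip_filter_ne {n : ℕ} (x y : Cube n) :
    flip x (Finset.univ.filter fun i => y i ≠ x i) = y := by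
  have key : ∀ a b : ZMod 2, b ≠ a → a + 1 = b := by decide
  funext i
  by_cases h : y i = x i
  · simp [flip, h]
  · simp [flip, h, key _ _ h]

theorem flip_flip_singleton {n : ℕ} (x : Cube n) (S : Finset (Fin n)) {i : Fin n} (hi : i ∈ S) :
    flip (flip x S) {i} = flip x (S.erase i) := by
  have key : ∀ a : ZMod 2, a + 1 + 1 = a := by decide
  funext j
  by_cases h : j = i
  · subst h; simp [flip, hi, key]
  · simp [flip, h]

/-- The families of `k` disjoint sensitive blocks of `f` on `x`. -/
def IsBlockFamily {n : ℕ} (f : BoolFun n) (x : Cube n) {k : ℕ} (S : Fin k → Finset (Fin n)) :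
    Prop :=
  (∀ i j, i ≠ j → Disjoint (S i) (S j)) ∧ ∀ i, f (flip x (S i)) ≠ f x

/-- Disjoint blocks that all meet `J` are at most `J.card` many. -/
theorem card_le_of_disjoint_of_meets {n k : ℕ} {S : Fin k → Finset (Fin n)}
    (hS : ∀ i j, i ≠ j → Disjoint (S i) (S j)) (J : Finset (Fin n))
    (hJ : ∀ i, ∃ j ∈ S i, j ∈ J) : k ≤ J.card := by
  choose p hp hpJ using hJ
  have hinj : Function.Injective p := by
    intro a b hab
    by_contra hne
    exact (Finset.disjoint_left.mp (hS a b hne) (hp a)) (hab ▸ hp b)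
  have := Finset.card_le_card_of_injOn (s := Finset.univ) (t := J) p (fun i _ => hpJ i)
    hinj.injOn
  simpa using this

theorem IsBlockFamily.le {n k : ℕ} {f : BoolFun n} {x : Cube n} {S : Fin k → Finset (Fin n)}
    (hS : IsBlockFamily f x S) : k ≤ n := by
  have := card_le_of_disjoint_of_meets hS.1 Finset.univ (fun i => by
    have hne : (S i).Nonempty := by
      rw [Finset.nonempty_iff_ne_empty]
      intro h
      apply hS.2 i
      rw [h]
      congr 1
    obtain ⟨j, hj⟩ := hne
    exact ⟨j, hj, Finset.mem_univ _⟩)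
  simpa using this

theorem IsBlockFamily.le_bsAt {n k : ℕ} {f : BoolFun n} {x : Cube n}
    {S : Fin k → Finset (Fin n)} (hS : IsBlockFamily f x S) : k ≤ bsAt f x :=
  le_csSup ⟨n, fun _ ⟨_, hT⟩ => IsBlockFamily.le hT⟩ ⟨S, hS⟩

theorem bsAt_le_bs {n : ℕ} (f : BoolFun n) (x : Cube n) : bsAt f x ≤ bs f :=
  Finset.le_sup (f := fun x => bsAt f x) (Finset.mem_univ x)

theorem exists_isBlockFamily_bsAt {n : ℕ} (f : BoolFun n) (x : Cube n) :
    ∃ S : Fin (bsAt f x) → Finset (Fin n), IsBlockFamily f x S :=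
  Nat.sSup_mem (s := {k : ℕ | ∃ S : Fin k → Finset (Fin n), IsBlockFamily f x S})
    ⟨0, fun i => i.elim0, fun i => i.elim0, fun i => i.elim0⟩
    ⟨n, fun _ ⟨_, hT⟩ => IsBlockFamily.le hT⟩

theorem bsAt_le_of_forall {n : ℕ} {f : BoolFun n} {x : Cube n} {r : ℕ}
    (h : ∀ (k : ℕ) (S : Fin k → Finset (Fin n)), IsBlockFamily f x S → k ≤ r) :
    bsAt f x ≤ r := by
  obtain ⟨S, hS⟩ := exists_isBlockFamily_bsAt f x
  exact h _ S hS

/-- A minimal sensitive block has at most `bs f` elements. -/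
theorem card_le_bs_of_minimal {n : ℕ} {f : BoolFun n} {x : Cube n} {T : Finset (Fin n)}
    (hT : Minimal (fun T => f (flip x T) ≠ f x) T) : T.card ≤ bs f := by
  -- From `flip x T`, undoing any one element of `T` restores the value `f x` by minimality, so the
  -- singletons of `T` are sensitive there.
  refine le_trans ?_ (bsAt_le_bs f (flip x T))
  refine IsBlockFamily.le_bsAt (S := fun i => {(T.equivFin.symm i : Fin n)}) ⟨?_, ?_⟩
  · intro i j hij
    simpa [Subtype.ext_iff] using fun h => hij (T.equivFin.symm.injective (Subtype.ext h))
  · intro i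
    have hi := (T.equivFin.symm i).2
    rw [flip_flip_singleton x T hi]
    have : ¬ f (flip x (T.erase (T.equivFin.symm i : Fin n))) ≠ f x := fun h =>
      hT.not_prop_of_lt (Finset.erase_ssubset hi) h
    rw [not_not.mp this]
    exact hT.prop.symm

/-- Shrink a maximum disjoint family of sensitive blocks to minimal ones and take their union. A
point agreeing with `x` there but with another value would differ from `x` on one more disjoint
sensitive block. -/
theorem exists_certificate_card_le_bs_sq {n : ℕ} (f : BoolFun n) (x : Cube n) :
    ∃ U : Finset (Fin n), U.card ≤ bs f ^ 2 ∧ ∀ y : Cube n, (∀ i ∈ U, y i = x i) → f y = f x := by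
  obtain ⟨S, hS⟩ := exists_isBlockFamily_bsAt f x
  have hmin : ∀ i, ∃ T ≤ S i, Minimal (fun T => f (flip x T) ≠ f x) T := fun i =>
    exists_minimal_le_of_wellFoundedLT (fun T => f (flip x T) ≠ f x) (S i) (hS.2 i)
  choose T hTS hT using hmin
  refine ⟨Finset.univ.biUnion T, ?_, ?_⟩
  · calc (Finset.univ.biUnion T).card ≤ ∑ i, (T i).card := Finset.card_biUnion_le
      _ ≤ ∑ _i : Fin (bsAt f x), bs f :=
        Finset.sum_le_sum fun i _ => card_le_bs_of_minimal (hT i)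
      _ = bsAt f x * bs f := by simp
      _ ≤ bs f ^ 2 := by rw [sq]; exact Nat.mul_le_mul_right _ (bsAt_le_bs f x)
  · intro y hy
    by_contra hne
    have hdisj : ∀ i, Disjoint (Finset.univ.filter fun j => y j ≠ x j) (T i) := by
      intro i
      rw [Finset.disjoint_left]
      intro j hj hjT
      exact (Finset.mem_filter.mp hj).2
        (hy j (Finset.mem_biUnion.mpr ⟨i, Finset.mem_univ _, hjT⟩))
    have hfam : IsBlockFamily f x
        (Fin.cons (Finset.univ.filter fun j => y j ≠ x j) T : Fin (bsAt f x + 1) → _) := by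
      refine ⟨fun i j => ?_, fun i => ?_⟩
      · refine Fin.cases ?_ (fun i => ?_) i <;> refine Fin.cases ?_ (fun j => ?_) j
        · simp
        · intro _; simpa using hdisj j
        · intro _; simpa using (hdisj i).symm
        · intro hij
          simp only [Fin.cons_succ]
          exact (hS.1 i j (fun h => hij (h ▸ rfl))).mono (hTS i) (hTS j)
      · refine Fin.cases ?_ (fun i => ?_) i
        · simp only [Fin.cons_zero, flip_filter_ne]; exact hne
        · simp only [Fin.cons_succ]; exact (hT i).prop
    exact absurd hfam.le_bsAt (by omega)

theorem cert_le_bs_sq {n : ℕ} (f : BoolFun n) : cert f ≤ bs f ^ 2 := by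
  refine max_le (Nat.sInf_le fun x hx => ?_) (Nat.sInf_le fun x hx => ?_)
  all_goals
    obtain ⟨U, hU, h⟩ := exists_certificate_card_le_bs_sq f x
    refine ⟨U, hU, fun y hy => ?_⟩
    simpa [h y hy] using hx

theorem certInv_le_bsInv_sq {n : ℕ} (f : BoolFun n) : certInv f ≤ bsInv f ^ 2 := by
  obtain ⟨B, hB⟩ : ∃ B, bs (rotate f B) = bsInv f :=
    Nat.sInf_mem (Set.range_nonempty fun B : Cube n ≃ₗ[ZMod 2] Cube n => bs (rotate f B))
  rw [← hB]
  exact (ciInf_le (OrderBot.bddBelow _) B).trans (cert_le_bs_sq _)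

theorem certOne_spec {n : ℕ} (f : BoolFun n) (x : Cube n) (hx : f x = true) :
    ∃ S : Finset (Fin n), S.card ≤ certOne f ∧
      ∀ x' : Cube n, (∀ i ∈ S, x' i = x i) → f x' = true :=
  Nat.sInf_mem (s := {k : ℕ | ∀ x : Cube n, f x = true →
    ∃ S : Finset (Fin n), S.card ≤ k ∧ ∀ x' : Cube n, (∀ i ∈ S, x' i = x i) → f x' = true})
    ⟨n, fun y hy => ⟨Finset.univ, by simp, fun y' h => by
      rwa [show y' = y from funext fun i => h i (Finset.mem_univ i)]⟩⟩ x hx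

theorem cert_spec {n : ℕ} (f : BoolFun n) (x : Cube n) :
    ∃ S : Finset (Fin n), S.card ≤ cert f ∧
      ∀ x' : Cube n, (∀ i ∈ S, x' i = x i) → f x' = f x := by
  cases hx : f x
  · obtain ⟨S, hS, h⟩ := certOne_spec (fun x => !(f x)) x (by simp [hx])
    exact ⟨S, hS.trans (le_max_left _ _), fun x' hx' => by simpa using h x' hx'⟩
  · obtain ⟨S, hS, h⟩ := certOne_spec f x hx
    exact ⟨S, hS.trans (le_max_right _ _), h⟩

/-! ### Parity block sensitivity versus parity certificates. -/

/-- Every subspace is spanned by some of the vectors of a suitable basis. -/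
theorem exists_equiv_mem_of_support {m : ℕ} (W : Submodule (ZMod 2) (Cube m)) :
    ∃ (B : Cube m ≃ₗ[ZMod 2] Cube m) (J : Finset (Fin m)),
      J.card = m - Module.finrank (ZMod 2) W ∧
        ∀ y : Cube m, (∀ i ∈ J, y i = 0) → B y ∈ W := by
  obtain ⟨W', hW⟩ := W.exists_isCompl
  have hsum : Module.finrank (ZMod 2) W + Module.finrank (ZMod 2) W' = m := by
    simpa using Submodule.finrank_add_eq_of_isCompl hW
  set d := Module.finrank (ZMod 2) W
  set d' := Module.finrank (ZMod 2) W'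
  let b := (Module.finBasis (ZMod 2) W).prod (Module.finBasis (ZMod 2) W')
  let σ : Fin d ⊕ Fin d' ≃ Fin m := finSumFinEquiv.trans (finCongr hsum)
  let B : Cube m ≃ₗ[ZMod 2] Cube m :=
    (b.reindex σ).equivFun.symm.trans (Submodule.prodEquivOfIsCompl W W' hW)
  refine ⟨B, Finset.univ.map (Function.Embedding.inr.trans σ.toEmbedding), by simp; omega, ?_⟩
  intro y hy
  have hy' : ∀ i, y (σ (Sum.inr i)) = 0 := fun i => hy _ (by simp)
  have hB : B y = ∑ i : Fin d, y (σ (Sum.inl i)) • (Module.finBasis (ZMod 2) W i : Cube m) := by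
    simp only [B, LinearEquiv.trans_apply, Module.Basis.equivFun_symm_apply, map_sum, map_smul]
    rw [← σ.sum_comp]
    simp [b, hy', Fintype.sum_sum_type]
  rw [hB]
  exact W.sum_mem fun i _ => W.smul_mem _ (Subtype.coe_prop _)

/-- In a basis extending one of `W`, a block using only `W`-coordinates is not sensitive, so
disjoint sensitive blocks each need their own coordinate outside `W`. -/
theorem weakParityBsAt_le {m : ℕ} (g : BoolFun m) (x : Cube m) (W : Submodule (ZMod 2) (Cube m))
    (hg : ∀ w ∈ W, g (x + w) = g x) :
    weakParityBsAt g x ≤ m - Module.finrank (ZMod 2) W := by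
  obtain ⟨B, J, hJ, hB⟩ := exists_equiv_mem_of_support W
  refine (ciInf_le (OrderBot.bddBelow _) B).trans ?_
  rw [← hJ]
  refine bsAt_le_of_forall fun k S hS => card_le_of_disjoint_of_meets hS.1 J fun i => ?_
  by_contra! hno
  apply hS.2 i
  simp only [rotate, flip_eq_add, map_add, LinearEquiv.apply_symm_apply]
  exact hg _ (hB _ fun j hj => by simpa using fun hjS => hno j hjS hj)

/-- The left side is the rank of the map induced by `L` into the quotient by `V`. -/
theorem sub_finrank_comap_le {n m : ℕ} (L : Cube m →ₗ[ZMod 2] Cube n)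
    (V : Submodule (ZMod 2) (Cube n)) :
    m - Module.finrank (ZMod 2) (V.comap L) ≤ n - Module.finrank (ZMod 2) V := by
  have h1 := (V.mkQ.comp L).finrank_range_add_finrank_ker
  have h2 : (V.mkQ.comp L).ker = V.comap L := by rw [LinearMap.ker_comp, Submodule.ker_mkQ]
  have h3 := V.finrank_quotient_add_finrank
  have h4 := Submodule.finrank_le (V.mkQ.comp L).range
  rw [h2] at h1
  simp only [Module.finrank_fin_fun] at h1 h3
  omega

theorem exists_isParityCert {n : ℕ} (f : BoolFun n) (x : Cube n) :
    ∃ S : AffineSubspace (ZMod 2) (Cube n), IsParityCert f x S ∧ codim S ≤ parityCert f := by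
  obtain ⟨S, hS, hc⟩ := Nat.sInf_mem (s := {k : ℕ | ∃ S : AffineSubspace (ZMod 2) (Cube n),
    IsParityCert f x S ∧ codim S = k})
    ⟨_, AffineSubspace.mk' x ⊥, ⟨AffineSubspace.self_mem_mk' _ _, fun y hy => by
      rw [AffineSubspace.mem_mk', Submodule.mem_bot, vsub_eq_zero_iff_eq] at hy
      rw [hy]⟩, rfl⟩
  refine ⟨S, hS, ?_⟩
  rw [hc]
  exact Finset.le_sup (f := fun x => parityCertAt f x) (Finset.mem_univ x)

/-- A parity certificate of `f` pulls back along the parametrization of the coset, without increase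
of co-dimension. -/
theorem parityBs_le_parityCert {n : ℕ} (f : BoolFun n) : parityBs f ≤ parityCert f := by
  refine csSup_le' ?_
  rintro _ ⟨m, H, c, e, -, rfl⟩
  refine Finset.sup_le fun x _ => ?_
  let L : Cube m →ₗ[ZMod 2] Cube n := Fintype.linearCombination (ZMod 2) fun i => (e i : Cube n)
  have hL : ∀ y, restrictCoset f H c e y = f (c + L y) := fun y => by
    simp [restrictCoset, L, Fintype.linearCombination_apply]
  obtain ⟨S, hS, hc⟩ := exists_isParityCert f (c + L x)
  refine (weakParityBsAt_le _ x (S.direction.comap L) fun w hw => ?_).trans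
    ((sub_finrank_comap_le L S.direction).trans hc)
  rw [hL, hL]
  apply hS.2
  rw [map_add, ← add_assoc, add_comm]
  exact S.vadd_mem_of_mem_direction hw hS.1

/-! ### Counting sparse combinations of rows. -/

open Matrix

/-- If `|M| t^|A| < |E|^|A|`, some family `h : A → E` is contained in none of the sets `T m`,
`m : M`, of size at most `t`. -/
theorem exists_family_forall_exists_notMem {M A E : Type*} [Fintype M] [Fintype A] [Fintype E]
    [DecidableEq A] [DecidableEq E] (T : M → Finset E) (t : ℕ) (hT : ∀ m, (T m).card ≤ t)
    (hlt : Fintype.card M * t ^ Fintype.card A < Fintype.card E ^ Fintype.card A) :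
    ∃ h : A → E, ∀ m, ∃ a, h a ∉ T m := by
  by_contra! hno
  have hsub : (Finset.univ : Finset (A → E)) ⊆
      Finset.univ.biUnion fun m => Fintype.piFinset fun _ : A => T m := by
    intro h _
    obtain ⟨m, hm⟩ := hno h
    exact Finset.mem_biUnion.mpr ⟨m, Finset.mem_univ _, Fintype.mem_piFinset.mpr hm⟩
  have hcard : Fintype.card E ^ Fintype.card A ≤ Fintype.card M * t ^ Fintype.card A := by
    calc Fintype.card E ^ Fintype.card A = (Finset.univ : Finset (A → E)).card := by simp
      _ ≤ _ := Finset.card_le_card hsub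
      _ ≤ ∑ m, (Fintype.piFinset fun _ : A => T m).card := Finset.card_biUnion_le
      _ ≤ ∑ _m : M, t ^ Fintype.card A := Finset.sum_le_sum fun m _ => by
          simpa using Nat.pow_le_pow_left (hT m) _
      _ = _ := by simp
  omega

/-- The vectors of `𝔽₂ⁿ` of Hamming weight at most `s`. -/
def lowWeight (n s : ℕ) : Finset (Cube n) :=
  Finset.univ.filter fun u => (Finset.univ.filter fun i => u i ≠ 0).card ≤ s

/-- Give each zero coordinate weight 16 and each nonzero one weight 1: the total is `17 ^ n`, and
every vector counted has weight at least `16 ^ (n - s)`. -/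
theorem card_lowWeight_mul_le (n s : ℕ) : (lowWeight n s).card * 16 ^ (n - s) ≤ 17 ^ n := by
  have hsum : ∑ u : Cube n, ∏ i, (if u i = 0 then 16 else 1) = 17 ^ n := by
    have h2 : ∑ b : ZMod 2, (if b = 0 then 16 else 1) = 17 := by decide
    have h := Finset.prod_univ_sum (fun _ : Fin n => (Finset.univ : Finset (ZMod 2)))
      (fun _ b => if b = 0 then 16 else 1)
    rw [h2] at h
    simpa using h.symm
  rw [← hsum, ← smul_eq_mul, ← Finset.sum_const]
  refine (Finset.sum_le_sum fun u hu => ?_).trans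
    (Finset.sum_le_sum_of_subset (Finset.subset_univ (lowWeight n s)))
  have hw := (Finset.mem_filter.mp hu).2
  have hc := Finset.card_filter_add_card_filter_not (s := (Finset.univ : Finset (Fin n)))
    (fun i => u i = 0)
  rw [Finset.prod_ite, Finset.prod_const, Finset.prod_const, one_pow, mul_one]
  refine Nat.pow_le_pow_right (by norm_num) ?_
  simp only [Finset.card_univ, Fintype.card_fin] at hc
  simp only [ne_eq] at hw
  omega

theorem card_lowWeight_le (t : ℕ) : (lowWeight (32 * t) t).card ≤ 2 ^ (8 * t) := by
  have h := card_lowWeight_mul_le (32 * t) t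
  have h17 : 17 ^ (32 * t) ≤ 2 ^ (8 * t) * 16 ^ (32 * t - t) := by
    rw [show 32 * t - t = 31 * t by omega, pow_mul, pow_mul, pow_mul, ← mul_pow]
    -- This is the numerical fact `17 ^ 32 ≤ 2 ^ 8 * 16 ^ 31`.
    exact Nat.pow_le_pow_left (by norm_num) t
  exact Nat.le_of_mul_le_mul_right (h.trans h17) (by positivity)

/-- A linear form that vanishes where some rows of `M` and all rows of `P` vanish is a
combination of these rows. -/
theorem exists_eq_vecMul_add_vecMul {n k : ℕ} (M : Matrix (Fin n) (Fin n) (ZMod 2))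
    (P : Matrix (Fin k) (Fin n) (ZMod 2)) (S : Finset (Fin n)) (w : Cube n)
    (hw : ∀ z, (∀ i ∈ S, (M *ᵥ z) i = 0) → P *ᵥ z = 0 → w ⬝ᵥ z = 0) :
    ∃ (u : Cube n) (v : Cube k), (∀ i ∉ S, u i = 0) ∧ w = u ᵥ* M + v ᵥ* P := by
  let form : Cube n →ₗ[ZMod 2] (Cube n →ₗ[ZMod 2] ZMod 2) := dotProductBilin (ZMod 2) (ZMod 2)
  let rows : S ⊕ Fin k → Cube n := Sum.elim (fun i => M i) P
  have hmem : form w ∈ Submodule.span (ZMod 2) (Set.range fun i => form (rows i)) := by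
    refine mem_span_of_iInf_ker_le_ker fun z hz => ?_
    simp only [Submodule.mem_iInf, LinearMap.mem_ker] at hz ⊢
    exact hw z (fun i hi => hz (Sum.inl ⟨i, hi⟩)) (funext fun j => hz (Sum.inr j))
  obtain ⟨c, hc⟩ := (Submodule.mem_span_range_iff_exists_fun _).mp hmem
  have hwc : w = ∑ i, c i • rows i := by
    have h1 : form w = form (∑ i, c i • rows i) := by rw [← hc]; simp
    ext j
    have := LinearMap.congr_fun h1 (Pi.single j 1)
    simpa [form, dotProductBilin] using this
  refine ⟨fun i => if h : i ∈ S then c (Sum.inl ⟨i, h⟩) else 0, fun j => c (Sum.inr j),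
    fun i hi => by simp [hi], ?_⟩
  rw [hwc, Fintype.sum_sum_type, vecMul_eq_sum, vecMul_eq_sum]
  congr 1
  rw [← Finset.sum_subset (Finset.subset_univ S) (fun i _ hi => by simp [hi]),
    ← Finset.sum_coe_sort S]
  refine Finset.sum_congr rfl fun i _ => ?_
  simp only [Finset.coe_mem, dite_true, Subtype.coe_eta]
  rfl

/-- The vectors spanned by the rows of `P` and at most `s` rows of `M`. -/
def sparseSpan {n k : ℕ} (s : ℕ) (P : Matrix (Fin k) (Fin n) (ZMod 2))
    (M : Matrix (Fin n) (Fin n) (ZMod 2)) : Finset (Cube n) :=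
  (lowWeight n s ×ˢ (Finset.univ : Finset (Cube k))).image fun p => p.1 ᵥ* M + p.2 ᵥ* P

theorem card_sparseSpan_le {n k : ℕ} (s : ℕ) (P : Matrix (Fin k) (Fin n) (ZMod 2))
    (M : Matrix (Fin n) (Fin n) (ZMod 2)) :
    (sparseSpan s P M).card ≤ (lowWeight n s).card * 2 ^ k := by
  refine Finset.card_image_le.trans ?_
  simp [Finset.card_product, ZMod.card]

/-! ### The addressing function. -/

/-- The addressing function that reads an address `P x` and answers with the parity `h (P x) ⬝ᵥ x`
stored there. -/
def parityAddress {n k : ℕ} (P : Matrix (Fin k) (Fin n) (ZMod 2)) (h : Cube k → Cube n) :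
    BoolFun n :=
  fun x => decide (h (P *ᵥ x) ⬝ᵥ x = 1)

theorem parityCert_parityAddress_le {n k : ℕ} (P : Matrix (Fin k) (Fin n) (ZMod 2))
    (h : Cube k → Cube n) : parityCert (parityAddress P h) ≤ k + 1 := by
  refine Finset.sup_le fun x _ => ?_
  let L : Cube n →ₗ[ZMod 2] Cube k × ZMod 2 :=
    P.mulVecLin.prod (dotProductBilin (ZMod 2) (ZMod 2) (h (P *ᵥ x)))
  have hcert : IsParityCert (parityAddress P h) x (AffineSubspace.mk' x L.ker) := by
    refine ⟨AffineSubspace.self_mem_mk' _ _, fun y hy => ?_⟩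
    rw [AffineSubspace.mem_mk', vsub_eq_sub, LinearMap.mem_ker, map_sub, sub_eq_zero] at hy
    obtain ⟨h1, h2⟩ := Prod.ext_iff.mp hy
    have h1' : P *ᵥ y = P *ᵥ x := h1
    have h2' : h (P *ᵥ x) ⬝ᵥ y = h (P *ᵥ x) ⬝ᵥ x := h2
    simp only [parityAddress, h1', h2']
  have h0 : parityCertAt (parityAddress P h) x ≤ codim (AffineSubspace.mk' x L.ker) :=
    Nat.sInf_le ⟨_, hcert, rfl⟩
  refine h0.trans ?_
  have h1 := L.finrank_range_add_finrank_ker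
  have h2 := Submodule.finrank_le L.range
  rw [Module.finrank_prod, Module.finrank_fin_fun, Module.finrank_self] at h2
  rw [Module.finrank_fin_fun] at h1
  rw [codim, AffineSubspace.direction_mk']
  exact Nat.sub_le_iff_le_add.mpr (h1.symm.le.trans (Nat.add_le_add_right h2 _))

theorem lt_certInv_parityAddress {n k s : ℕ} (P : Matrix (Fin k) (Fin n) (ZMod 2))
    (hP : Function.Surjective P.mulVec) (h : Cube k → Cube n)
    (hh : ∀ M, ∃ a, h a ∉ sparseSpan s P M) : s < certInv (parityAddress P h) := by
  refine lt_of_lt_of_le (Nat.lt_succ_self s) (le_ciInf fun B => ?_)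
  by_contra! hlt
  set M := LinearMap.toMatrix' B.symm.toLinearMap
  have hM : ∀ z, M *ᵥ z = B.symm z := fun z => LinearMap.toMatrix'_mulVec _ z
  obtain ⟨a, ha⟩ := hh M
  obtain ⟨x, hx⟩ := hP a
  have hx : P *ᵥ x = a := hx
  obtain ⟨S, hS, hcert⟩ := cert_spec (rotate (parityAddress P h) B) (B.symm x)
  apply ha
  -- A shift `z` that keeps the address and the certificate's coordinates preserves the value, hence
  -- the parity `h a`.
  obtain ⟨u, v, hu, huv⟩ := exists_eq_vecMul_add_vecMul M P S (h a) fun z hz hPz => by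
    have hconst := hcert (B.symm (x + z)) fun i hi => by
      rw [map_add, Pi.add_apply, ← hM z, hz i hi, add_zero]
    simp only [rotate, LinearEquiv.apply_symm_apply, parityAddress, mulVec_add, hPz, add_zero, hx,
      dotProduct_add, decide_eq_decide] at hconst
    have key : ∀ b c : ZMod 2, (b + c = 1 ↔ b = 1) → c = 0 := by decide
    exact key _ _ hconst
  refine Finset.mem_image.mpr ⟨(u, v), Finset.mem_product.mpr ⟨?_, Finset.mem_univ _⟩, huv.symm⟩
  refine Finset.mem_filter.mpr ⟨Finset.mem_univ _, ?_⟩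
  refine (Finset.card_le_card fun i hi => ?_).trans (hS.trans (Nat.lt_succ_iff.mp hlt))
  by_contra hiS
  exact (Finset.mem_filter.mp hi).2 (hu i hiS)

theorem card_cube (n : ℕ) : Fintype.card (Cube n) = 2 ^ n := by
  simp [ZMod.card]

theorem card_matrix (n : ℕ) :
    Fintype.card (Matrix (Fin n) (Fin n) (ZMod 2)) = 2 ^ (n * n) := by
  rw [pow_mul, ← card_cube]
  exact (Fintype.card_fun (α := Fin n) (β := Cube n)).trans (by rw [Fintype.card_fin])

theorem exists_parityCert_le_lt_certInv (j : ℕ) :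
    ∃ f : BoolFun (2 ^ (j + 5)), parityCert f ≤ j + 8 ∧ 2 ^ j < certInv f := by
  have hn : 2 ^ (j + 5) = 32 * 2 ^ j := by ring
  have hj : j < 2 ^ j := Nat.lt_two_pow_self
  have hk : j + 7 ≤ 2 ^ (j + 5) := by omega
  -- Any surjective address map would do; this one reads the first `j + 7` bits.
  let π : Cube (2 ^ (j + 5)) →ₗ[ZMod 2] Cube (j + 7) :=
    LinearMap.funLeft (ZMod 2) (ZMod 2) (Fin.castLE hk)
  let P := LinearMap.toMatrix' π
  have hP : Function.Surjective P.mulVec := by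
    have : P.mulVec = π := funext fun z => LinearMap.toMatrix'_mulVec _ z
    rw [this]
    exact LinearMap.funLeft_surjective_of_injective _ _ _ (Fin.castLE_injective hk)
  have hcard : ∀ M, (sparseSpan (2 ^ j) P M).card ≤ 2 ^ (16 * 2 ^ j) := fun M => by
    refine (card_sparseSpan_le _ P M).trans ?_
    have h1 : (lowWeight (2 ^ (j + 5)) (2 ^ j)).card ≤ 2 ^ (8 * 2 ^ j) := by
      rw [hn]; exact card_lowWeight_le _
    calc _ ≤ 2 ^ (8 * 2 ^ j) * 2 ^ (8 * 2 ^ j) :=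
          Nat.mul_le_mul h1 (Nat.pow_le_pow_right (by norm_num) (by omega))
      _ = _ := by rw [← pow_add]; congr 1; ring
  obtain ⟨h, hh⟩ := exists_family_forall_exists_notMem (A := Cube (j + 7))
    (sparseSpan (2 ^ j) P) _ hcard (by
      rw [card_matrix, card_cube, card_cube, ← pow_mul, ← pow_mul, ← pow_add]
      refine (Nat.pow_lt_pow_iff_right (by norm_num : 1 < 2)).mpr ?_
      have h7 : 2 ^ (j + 7) = 128 * 2 ^ j := by ring
      rw [hn, h7]
      -- With `t = 2 ^ j` the exponents compare as `1024 t² + 2048 t² < 4096 t²`.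
      nlinarith)
  exact ⟨parityAddress P h, parityCert_parityAddress_le P h, lt_certInv_parityAddress P hP h hh⟩

theorem two_rpow_le_of_pow_le_sq {j p b : ℕ} (hp : p ≤ 2 * j) (hb : 2 ^ j ≤ b ^ 2) :
    (2 : ℝ) ^ ((1 / 4 : ℝ) * p) ≤ b := by
  refine le_of_sq_le_sq ?_ (Nat.cast_nonneg b)
  have hb' : (2 : ℝ) ^ j ≤ (b : ℝ) ^ 2 := by exact_mod_cast hb
  refine le_trans ?_ hb'
  rw [← Real.rpow_natCast, ← Real.rpow_mul zero_le_two, ← Real.rpow_natCast 2 j]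
  refine Real.rpow_le_rpow_of_exponent_le one_le_two ?_
  have : (p : ℝ) ≤ 2 * j := by exact_mod_cast hp
  push_cast
  linarith

end ParityComplexity

theorem mainTheorem5 :
    ∃ K c δ : ℝ, 0 < K ∧ 0 < c ∧ 0 < δ ∧
      {n : ℕ | ∃ f : ParityComplexity.BoolFun n,
        ((ParityComplexity.parityCert f : ℝ) ≤ K * Real.log n ∧
          c * n ≤ (ParityComplexity.certInv f : ℝ) ∧
          (2 : ℝ) ^ (δ * (ParityComplexity.parityCert f : ℝ)) ≤
            (ParityComplexity.certInv f : ℝ)) ∧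
        ((ParityComplexity.parityBs f : ℝ) ≤ K * Real.log n ∧
          c * Real.sqrt n ≤ (ParityComplexity.bsInv f : ℝ) ∧
          (2 : ℝ) ^ (δ * (ParityComplexity.parityBs f : ℝ)) ≤
            (ParityComplexity.bsInv f : ℝ))}.Infinite := by
  refine ⟨4, 1 / 32, 1 / 4, by norm_num, by norm_num, by norm_num, ?_⟩
  -- The shift by 8 ensures `j + 8 ≤ 2 * j`, which `δ = 1/4` requires.
  refine Set.infinite_of_injective_forall_mem (f := fun j : ℕ => 2 ^ (j + 8 + 5))
    (fun a b hab => by simpa using Nat.pow_right_injective le_rfl hab) fun i => ?_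
  obtain ⟨j, hj⟩ : ∃ j, j = i + 8 := ⟨_, rfl⟩
  rw [← hj]
  obtain ⟨f, hup, hlow⟩ := ParityComplexity.exists_parityCert_le_lt_certInv j
  have hbs := ParityComplexity.certInv_le_bsInv_sq f
  have hpar := ParityComplexity.parityBs_le_parityCert f
  have hlog : ∀ p : ℕ, p ≤ j + 8 → (p : ℝ) ≤ 4 * Real.log ((2 ^ (j + 5) : ℕ) : ℝ) := by
    intro p hp
    have h1 : (p : ℝ) ≤ j + 8 := by exact_mod_cast hp
    have h2 := Real.log_two_gt_d9
    have h3 : (0 : ℝ) ≤ j := Nat.cast_nonneg j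
    rw [Nat.cast_pow, Real.log_pow]
    push_cast
    nlinarith
  have hsq : 2 ^ j ≤ ParityComplexity.bsInv f ^ 2 := hlow.le.trans hbs
  have hn : (((2 ^ (j + 5) : ℕ)) : ℝ) = 32 * 2 ^ j := by push_cast; ring
  refine ⟨f, ⟨hlog _ hup, ?_, ?_⟩, hlog _ (hpar.trans hup), ?_, ?_⟩
  · have : (2 : ℝ) ^ j ≤ ParityComplexity.certInv f := by exact_mod_cast hlow.le
    rw [hn]
    linarith
  · exact ParityComplexity.two_rpow_le_of_pow_le_sq (by omega)
      (hlow.le.trans (Nat.le_self_pow two_ne_zero _))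
  · have h1 : (2 : ℝ) ^ j ≤ (ParityComplexity.bsInv f : ℝ) ^ 2 := by exact_mod_cast hsq
    have h2 : Real.sqrt ((2 ^ (j + 5) : ℕ) : ℝ) ≤ 32 * ParityComplexity.bsInv f := by
      rw [hn]
      exact Real.sqrt_le_iff.mpr ⟨by positivity, by
        nlinarith [sq_nonneg (ParityComplexity.bsInv f : ℝ)]⟩
    linarith
  · exact ParityComplexity.two_rpow_le_of_pow_le_sq (by omega) hsq
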